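/- Let $d, N \geq 1$ be integers and let $\Psi_N \in (\mathbb{C}^d)^{\otimes N}$ be a unit vector. Suppose that $\Psi_N$ is fermionic, i.e. $\Psi_N$ lies in the antisymmetric subspace $\Lambda^N \mathbb{C}^d \subset (\mathbb{C}^d)^{\otimes N}$ (a nonzero such vector exists only if $N \leq d$); or that it is bosonic, i.e. invariant under all permutations of the tensor factors; or, more generally, that the projector $\rho_N = |\Psi_N\rangle\langle\Psi_N|$ is permutation-invariant, i.e. $U_\sigma \rho_N U_\sigma^* = \rho_N$ for every unitary $U_\sigma$ that permutes the $N$ tensor factors. For $1 \leq k \leq N$ let $\gamma_k = \operatorname{Tr}_{k+1,\ldots,N}[\rho_N]$ be the $k$-body reduced density matrix, where the (trace-preserving) partial trace is over the last $N-k$ factors of $(\mathbb{C}^d)^{\otimes N} = (\mathbb{C}^d)^{\otimes k} \otimes (\mathbb{C}^d)^{\otimes (N-k)}$, and let $S_k = -\operatorname{Tr}[\gamma_k \log \gamma_k]$ be its von Neumann entropy, with $0\log 0=0$. Then: (i) (Monotonicity) $S_k \leq S_{k+1}$ for every integer $k$ with $1 \leq k \leq \frac{N}{2} - 1$. (ii)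 (Concavity) $S_k \geq \frac{S_{k+1} + S_{k-1}}{2}$ for every integer $k$ with $2 \leq k \leq N-1$. -/

import Mathlib

namespace FermionEntropy

/-- The Hilbert space `(ℂ^d)^{⊗ N}`, in the coordinates of the product orthonormal basis
`e_{x 0} ⊗ ⋯ ⊗ e_{x (N-1)}`, `x : Fin N → Fin d`. -/
abbrev TensorPower (d N : ℕ) : Type := EuclideanSpace ℂ (Fin N → Fin d)

/-- Operators on `(ℂ^d)^{⊗ N}`, as matrices in the product basis. -/
abbrev Op (d N : ℕ) : Type := Matrix (Fin N → Fin d) (Fin N → Fin d) ℂ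

/-- The antisymmetric subspace `Λ^N ℂ^d` of `(ℂ^d)^{⊗ N}`: a permutation of the tensor factors acts
by its sign. -/
def antisymmetricSubspace (d N : ℕ) : Submodule ℂ (TensorPower d N) where
  carrier := {Ψ | ∀ (σ : Equiv.Perm (Fin N)) (x : Fin N → Fin d),
    Ψ (x ∘ σ) = ((Equiv.Perm.sign σ : ℤ) : ℂ) * Ψ x}
  add_mem' := by
    intro a b ha hb σ x
    simp only [PiLp.add_apply, ha σ x, hb σ x, mul_add]
  zero_mem' := by
    intro σ x
    simp
  smul_mem' := by
    intro c a ha σ x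
    simp only [PiLp.smul_apply, ha σ x, smul_eq_mul]
    ring

/-- The symmetric (bosonic) subspace of `(ℂ^d)^{⊗ N}`: permutations of the tensor factors act
trivially. -/
def symmetricSubspace (d N : ℕ) : Submodule ℂ (TensorPower d N) where
  carrier := {Ψ | ∀ (σ : Equiv.Perm (Fin N)) (x : Fin N → Fin d), Ψ (x ∘ σ) = Ψ x}
  add_mem' := by
    intro a b ha hb σ x
    simp only [PiLp.add_apply, ha σ x, hb σ x]
  zero_mem' := by
    intro σ x
    simp
  smul_mem' := by
    intro c a ha σ x
    simp only [PiLp.smul_apply, ha σ x]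

/-- The operator `|Ψ⟩⟨Ψ|`. It is a projector when `‖Ψ‖ = 1`. -/
def pureState {d N : ℕ} (Ψ : TensorPower d N) : Op d N :=
  Matrix.of fun x y => Ψ x * star (Ψ y)

/-- `ρ` is invariant under conjugation by every unitary that permutes the tensor factors. -/
def IsPermutationInvariant {d N : ℕ} (ρ : Op d N) : Prop :=
  ∀ (σ : Equiv.Perm (Fin N)) (x y : Fin N → Fin d), ρ (x ∘ σ) (y ∘ σ) = ρ x y

/-- For `k ≤ N`, the identification `(ℂ^d)^{⊗ k} ⊗ (ℂ^d)^{⊗ (N-k)} = (ℂ^d)^{⊗ N}` on basis indices: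
the tuple `x` followed by the tuple `z`. -/
def concat {d N k : ℕ} (x : Fin k → Fin d) (z : Fin (N - k) → Fin d) : Fin N → Fin d :=
  fun i => if h : (i : ℕ) < k then x ⟨i, h⟩ else z ⟨(i : ℕ) - k, by omega⟩

/-- The `k`-body reduced density matrix (`k ≤ N`): the trace-preserving partial trace of `ρ` over
the last `N - k` tensor factors. -/
def reducedDensity {d N : ℕ} (ρ : Op d N) (k : ℕ) : Op d k :=
  Matrix.of fun x y => ∑ z : Fin (N - k) → Fin d, ρ (concat x z) (concat y z)

/-- The von Neumann entropy `-Tr[γ log γ]` of a density matrix, natural logarithm, `0 log 0 = 0`.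
The logarithm is taken in the functional calculus of Hermitian matrices. -/
noncomputable def entropy {ι : Type*} [Fintype ι] [DecidableEq ι] (γ : Matrix ι ι ℂ) : ℝ :=
  -(Matrix.trace (γ * cfc Real.log γ)).re

end FermionEntropy

/-! Concavity is strong subadditivity. Split k + 1 factors into B (k - 1 factors), A and C (one
each): by permutation invariance the BA and BC marginals are both γ_k, so S(BAC) + S(B) ≤ S(BA) +
S(BC) is the claim (`entropy_concave`). For a pure state the Schmidt decomposition gives S_k =
S_{N-k} (`entropy_reducedDensity_compl`). By concavity the increments of S never grow, so S_k -
S_{k+1} = S_{N-k} - S_{N-k-1} ≤ S_{k+1} - S_k when 2k + 2 ≤ N, which is monotonicity.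

Strong subadditivity is the decrease of relative entropy when C is traced out, applied to ρ_BAC and
ρ_BC ⊗ 1_A. For that decrease (`relativeEntropy_partialTrace_le`), minus the relative entropy is the
mean of log Δ, where the relative modular operator Δ has eigenvalues s_j / r_i. Means of log are
compared through the resolvents (Δ + t)⁻¹ (`sum_mul_log_le_of_resolvent_le`). Each resolvent element
is the supremum of `resolventForm`, and the test matrices Y ⊗ 1 reproduce the form of the marginals,
so the marginal supremum is at most the full one. -/

namespace FermionEntropy

open Filter Topology Matrix
open scoped Kronecker

/-! ### Logarithmic moments from Stieltjes transforms -/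

/-- If two finitely supported measures on `(0, ∞)` have the same mass and their Stieltjes transforms
are ordered, then so are their logarithmic moments, in the opposite order. -/
theorem sum_mul_log_le_of_resolvent_le {m n : Type*} [Fintype m] [Fintype n]
    {c x : m → ℝ} {c' x' : n → ℝ} (hx : ∀ i, 0 < x i) (hx' : ∀ i, 0 < x' i)
    (hsum : ∑ i, c i = ∑ i, c' i)
    (h : ∀ t, 0 < t → ∑ i, c' i / (x' i + t) ≤ ∑ i, c i / (x i + t)) :
    ∑ i, c i * Real.log (x i) ≤ ∑ i, c' i * Real.log (x' i) := by
  let G : ℝ → ℝ := fun t =>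
    ∑ i, c i * Real.log (x i + t) - ∑ i, c' i * Real.log (x' i + t)
  have hderiv : ∀ t, 0 ≤ t → HasDerivAt G
      (∑ i, c i / (x i + t) - ∑ i, c' i / (x' i + t)) t := by
    intro t ht
    have aux : ∀ a b : ℝ, 0 < a → HasDerivAt (fun t => b * Real.log (a + t)) (b / (a + t)) t := by
      intro a b ha
      have := (((hasDerivAt_id t).const_add a).log (by simp; positivity)).const_mul b
      simpa [div_eq_mul_inv] using this
    exact (HasDerivAt.fun_sum fun i _ => aux _ _ (hx i)).sub
      (HasDerivAt.fun_sum fun i _ => aux _ _ (hx' i))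
  have hmono : MonotoneOn G (Set.Ici 0) := by
    apply monotoneOn_of_deriv_nonneg (convex_Ici 0)
    · exact fun t ht => (hderiv t ht).continuousAt.continuousWithinAt
    · intro t ht
      rw [interior_Ici] at ht
      exact (hderiv t ht.le).differentiableAt.differentiableWithinAt
    · intro t ht
      rw [interior_Ici] at ht
      rw [(hderiv t ht.le).deriv, sub_nonneg]
      exact h t ht
  have hlim : Tendsto G atTop (𝓝 0) := by
    have aux : ∀ a b : ℝ, 0 < a →
        Tendsto (fun t => b * (Real.log (a + t) - Real.log t)) atTop (𝓝 0) := by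
      intro a b ha
      have h1 : Tendsto (fun t : ℝ => Real.log (a * t⁻¹ + 1)) atTop (𝓝 0) := by
        have h2 : Tendsto (fun t : ℝ => a * t⁻¹ + 1) atTop (𝓝 1) := by
          simpa using (tendsto_inv_atTop_zero.const_mul a).add_const (1 : ℝ)
        simpa using h2.log one_ne_zero
      have h3 : Tendsto (fun t : ℝ => Real.log (a + t) - Real.log t) atTop (𝓝 0) := by
        refine h1.congr' ?_
        filter_upwards [eventually_gt_atTop 0] with t ht
        rw [← Real.log_div (by positivity) ht.ne']
        congr 1
        field_simp
      simpa using h3.const_mul b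
    -- Equal masses make the subtracted `log t` terms cancel.
    have h4 : Tendsto (fun t => ∑ i, c i * (Real.log (x i + t) - Real.log t)
        - ∑ i, c' i * (Real.log (x' i + t) - Real.log t)) atTop (𝓝 0) := by
      simpa using (tendsto_finsetSum Finset.univ fun i _ => aux (x i) (c i) (hx i)).sub
        (tendsto_finsetSum Finset.univ fun i _ => aux (x' i) (c' i) (hx' i))
    refine h4.congr fun t => ?_
    simp only [mul_sub, Finset.sum_sub_distrib, ← Finset.sum_mul, hsum, G]
    ring
  have h0 : G 0 ≤ 0 := by
    refine ge_of_tendsto hlim ?_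
    filter_upwards [eventually_ge_atTop 0] with t ht
    exact hmono Set.self_mem_Ici ht ht
  simpa [G] using h0

/-! ### Variational form of the resolvent -/

/-- `ρ = U diag(r) Uᴴ` with `U` unitary, possibly between differently indexed spaces. -/
structure IsDiagonalization {n ι : Type*} [Fintype n] [DecidableEq n] [Fintype ι] [DecidableEq ι]
    (ρ : Matrix n n ℂ) (U : Matrix n ι ℂ) (r : ι → ℝ) : Prop where
  mul_conjTranspose : U * Uᴴ = 1
  conjTranspose_mul : Uᴴ * U = 1
  eq : ρ = U * diagonal (fun i => (r i : ℂ)) * Uᴴ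

section Resolvent

variable {n ι κ : Type*} [Fintype n] [DecidableEq n] [Fintype ι] [DecidableEq ι]
  [Fintype κ] [DecidableEq κ]

theorem IsDiagonalization.trace_mul_conj {ρ : Matrix n n ℂ} {U : Matrix n ι ℂ} {r : ι → ℝ}
    (h : IsDiagonalization ρ U r) (W : Matrix ι ι ℂ) :
    trace (ρ * (U * W * Uᴴ)) = ∑ i, (r i : ℂ) * W i i := by
  have : ρ * (U * W * Uᴴ) = U * ((diagonal (fun i => (r i : ℂ)) * W) * Uᴴ) := by
    rw [h.eq]
    simp only [Matrix.mul_assoc]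
    rw [← Matrix.mul_assoc Uᴴ U, h.conjTranspose_mul, Matrix.one_mul]
  rw [this, trace_mul_comm, Matrix.mul_assoc, h.conjTranspose_mul, Matrix.mul_one]
  simp [trace, diagonal_mul]

/-- The concave quadratic functional whose supremum over `Y` is the matrix element of the resolvent
`(Δ + t)⁻¹` of the relative modular operator of `σ` and `ρ` in the state `ρ^(1/2)`. -/
noncomputable def resolventForm (ρ σ : Matrix n n ℂ) (t : ℝ) (Y : Matrix n n ℂ) : ℝ :=
  (2 * trace (ρ * Y) - trace (σ * (Y * Yᴴ)) - t * trace (ρ * (Yᴴ * Y))).re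

variable {ρ σ : Matrix n n ℂ} {U : Matrix n ι ℂ} {r : ι → ℝ} {V : Matrix n κ ℂ} {s : κ → ℝ}

/-- In the eigenbases of σ and ρ the form decouples into one scalar quadratic per entry of `Z`. -/
theorem resolventForm_conj (hρ : IsDiagonalization ρ U r) (hσ : IsDiagonalization σ V s)
    (t : ℝ) (Z : Matrix κ ι ℂ) :
    resolventForm ρ σ t (V * Z * Uᴴ) = ∑ i, ∑ j, (2 * r i * ((Uᴴ * V) i j * Z j i).re
      - (s j + t * r i) * Complex.normSq (Z j i)) := by
  have h1 : trace (ρ * (V * Z * Uᴴ)) = ∑ i, (r i : ℂ) * ((Uᴴ * V) * Z) i i := by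
    rw [← hρ.trace_mul_conj]
    congr 2
    simp only [← Matrix.mul_assoc]
    rw [hρ.mul_conjTranspose, Matrix.one_mul]
  have h2 : trace (σ * ((V * Z * Uᴴ) * (V * Z * Uᴴ)ᴴ)) = ∑ j, (s j : ℂ) * (Z * Zᴴ) j j := by
    rw [← hσ.trace_mul_conj]
    congr 2
    simp only [conjTranspose_mul, conjTranspose_conjTranspose, Matrix.mul_assoc]
    rw [← Matrix.mul_assoc Uᴴ U, hρ.conjTranspose_mul, Matrix.one_mul]
  have h3 : trace (ρ * ((V * Z * Uᴴ)ᴴ * (V * Z * Uᴴ))) = ∑ i, (r i : ℂ) * (Zᴴ * Z) i i := by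
    rw [← hρ.trace_mul_conj]
    congr 2
    simp only [conjTranspose_mul, conjTranspose_conjTranspose, Matrix.mul_assoc]
    rw [← Matrix.mul_assoc Vᴴ V, hσ.conjTranspose_mul, Matrix.one_mul]
  have hn : ∀ z : ℂ, (z * star z) = (Complex.normSq z : ℂ) := fun z => Complex.mul_conj z
  have hn' : ∀ z : ℂ, (star z * z) = (Complex.normSq z : ℂ) := fun z =>
    (Complex.normSq_eq_conj_mul_self).symm
  rw [resolventForm, h1, h2, h3]
  simp only [Matrix.mul_apply (M := Uᴴ * V), Matrix.mul_apply (M := Z),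
    Matrix.mul_apply (M := Zᴴ), conjTranspose_apply, hn, hn', ← Complex.ofReal_sum,
    ← Complex.ofReal_mul]
  have h2re : ∀ (a : ℝ) (w : ℂ), (2 * ((a : ℂ) * w)).re = 2 * a * w.re := by
    intro a w
    rw [← Complex.ofReal_ofNat, ← mul_assoc, ← Complex.ofReal_mul, Complex.re_ofReal_mul]
  simp only [Complex.sub_re, Complex.ofReal_re, Complex.re_sum, Finset.mul_sum, h2re]
  rw [Finset.sum_comm (f := fun j i => s j * Complex.normSq (Z j i)), ← Finset.sum_sub_distrib,
    ← Finset.sum_sub_distrib]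
  refine Finset.sum_congr rfl fun i _ => ?_
  rw [← Finset.sum_sub_distrib, ← Finset.sum_sub_distrib]
  refine Finset.sum_congr rfl fun j _ => ?_
  ring

theorem resolventForm_le (hρ : IsDiagonalization ρ U r) (hσ : IsDiagonalization σ V s)
    (hr : ∀ i, 0 < r i) (hs : ∀ j, 0 < s j) {t : ℝ} (ht : 0 < t) (Y : Matrix n n ℂ) :
    resolventForm ρ σ t Y ≤
      ∑ i, ∑ j, r i ^ 2 * Complex.normSq ((Uᴴ * V) i j) / (s j + t * r i) := by
  have hY : Y = V * (Vᴴ * Y * U) * Uᴴ := by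
    simp only [Matrix.mul_assoc]
    rw [hρ.mul_conjTranspose, Matrix.mul_one, ← Matrix.mul_assoc, hσ.mul_conjTranspose,
      Matrix.one_mul]
  rw [hY, resolventForm_conj hρ hσ]
  refine Finset.sum_le_sum fun i _ => Finset.sum_le_sum fun j _ => ?_
  generalize (Uᴴ * V) i j = m
  generalize (Vᴴ * Y * U) j i = z
  have hp : 0 < s j + t * r i := by have := hr i; have := hs j; positivity
  rw [le_div_iff₀ hp]
  simp only [Complex.normSq_apply, Complex.mul_re]
  -- Completing the square: these are the real and imaginary parts of r conj(m) - p z, with p = s +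
  -- t r.
  nlinarith [sq_nonneg (r i * m.re - (s j + t * r i) * z.re),
    sq_nonneg (r i * m.im + (s j + t * r i) * z.im)]

theorem exists_resolventForm_eq (hρ : IsDiagonalization ρ U r) (hσ : IsDiagonalization σ V s)
    (hr : ∀ i, 0 < r i) (hs : ∀ j, 0 < s j) {t : ℝ} (ht : 0 < t) :
    ∃ Y, resolventForm ρ σ t Y =
      ∑ i, ∑ j, r i ^ 2 * Complex.normSq ((Uᴴ * V) i j) / (s j + t * r i) := by
  -- The entrywise maximiser z = r conj(m) / p.
  refine ⟨V * Matrix.of (fun j i => ((r i / (s j + t * r i) : ℝ) : ℂ) * star ((Uᴴ * V) i j)) * Uᴴ,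
    ?_⟩
  rw [resolventForm_conj hρ hσ]
  refine Finset.sum_congr rfl fun i _ => Finset.sum_congr rfl fun j _ => ?_
  rw [Matrix.of_apply]
  generalize (Uᴴ * V) i j = m
  have hp : 0 < s j + t * r i := by have := hr i; have := hs j; positivity
  have : (m * (((r i / (s j + t * r i) : ℝ) : ℂ) * star m)) =
      ((r i / (s j + t * r i) * Complex.normSq m : ℝ) : ℂ) := by
    rw [mul_left_comm, Complex.star_def, Complex.mul_conj, Complex.ofReal_mul]
  rw [this, Complex.ofReal_re, map_mul, Complex.star_def, Complex.normSq_conj,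
    Complex.normSq_ofReal]
  field_simp
  ring

/-- The two-index spectral weights `r i * |⟨u i, v j⟩|²` integrate functions of `σ` against `ρ`. -/
theorem sum_weights_mul (hρ : IsDiagonalization ρ U r) (V : Matrix n κ ℂ) (g : κ → ℝ) :
    ∑ i, ∑ j, r i * Complex.normSq ((Uᴴ * V) i j) * g j =
      (trace (ρ * (V * diagonal (fun j => (g j : ℂ)) * Vᴴ))).re := by
  have : V * diagonal (fun j => (g j : ℂ)) * Vᴴ =
      U * ((Uᴴ * V) * diagonal (fun j => (g j : ℂ)) * (Uᴴ * V)ᴴ) * Uᴴ := by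
    simp only [conjTranspose_mul, conjTranspose_conjTranspose, Matrix.mul_assoc]
    rw [hρ.mul_conjTranspose, Matrix.mul_one, ← Matrix.mul_assoc U, hρ.mul_conjTranspose,
      Matrix.one_mul]
  rw [this, hρ.trace_mul_conj, Complex.re_sum]
  refine Finset.sum_congr rfl fun i _ => ?_
  rw [Complex.re_ofReal_mul, Matrix.mul_apply, Complex.re_sum, Finset.mul_sum]
  refine Finset.sum_congr rfl fun j _ => ?_
  rw [mul_diagonal, conjTranspose_apply]
  generalize (Uᴴ * V) i j = m
  rw [mul_right_comm m, Complex.star_def, Complex.mul_conj, ← Complex.ofReal_mul,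
    Complex.ofReal_re, mul_assoc]

theorem sum_normSq_row (hρ : IsDiagonalization ρ U r) (hσ : IsDiagonalization σ V s) (i : ι) :
    ∑ j, Complex.normSq ((Uᴴ * V) i j) = 1 := by
  have h : (Uᴴ * V) * (Uᴴ * V)ᴴ = 1 := by
    simp only [conjTranspose_mul, conjTranspose_conjTranspose, Matrix.mul_assoc]
    rw [← Matrix.mul_assoc V, hσ.mul_conjTranspose, Matrix.one_mul, hρ.conjTranspose_mul]
  have h' := congrFun (congrFun h i) i
  rw [Matrix.mul_apply, one_apply_eq] at h'
  simp only [conjTranspose_apply, Complex.star_def, Complex.mul_conj, ← Complex.ofReal_sum] at h'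
  exact_mod_cast h'

theorem sum_weights_mul_left (hρ : IsDiagonalization ρ U r) (hσ : IsDiagonalization σ V s)
    (g : ι → ℝ) :
    ∑ i, ∑ j, r i * Complex.normSq ((Uᴴ * V) i j) * g i = ∑ i, r i * g i := by
  refine Finset.sum_congr rfl fun i _ => ?_
  rw [← Finset.sum_mul, ← Finset.mul_sum, sum_normSq_row hρ hσ, mul_one]

end Resolvent

/-! ### Monotonicity of relative entropy -/

/-- The partial trace over the second factor. -/
def partialTrace {α β : Type*} [Fintype β] (ρ : Matrix (α × β) (α × β) ℂ) : Matrix α α ℂ :=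
  Matrix.of fun x y => ∑ b, ρ (x, b) (y, b)

section PartialTrace

variable {α β : Type*} [Fintype α] [Fintype β] [DecidableEq β]

theorem trace_mul_kronecker_one (ρ : Matrix (α × β) (α × β) ℂ) (X : Matrix α α ℂ) :
    trace (ρ * (X ⊗ₖ (1 : Matrix β β ℂ))) = trace (partialTrace ρ * X) := by
  simp only [trace, diag_apply, Matrix.mul_apply, Fintype.sum_prod_type, kroneckerMap_apply,
    one_apply, partialTrace, of_apply, mul_ite, mul_one, mul_zero, Finset.sum_ite_eq',
    Finset.mem_univ, if_true, Finset.sum_mul]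
  refine Finset.sum_congr rfl fun i _ => ?_
  rw [Finset.sum_comm]

/-- Since Y ↦ Y ⊗ 1 respects products and adjoints, every trace in the form sees only the marginals.
-/
theorem resolventForm_kronecker_one (ρ σ : Matrix (α × β) (α × β) ℂ) (t : ℝ) (Y : Matrix α α ℂ) :
    resolventForm ρ σ t (Y ⊗ₖ (1 : Matrix β β ℂ)) =
      resolventForm (partialTrace ρ) (partialTrace σ) t Y := by
  simp only [resolventForm, conjTranspose_kronecker, conjTranspose_one, ← mul_kronecker_mul,
    Matrix.one_mul, trace_mul_kronecker_one]

variable [DecidableEq α]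

/-- The relative entropy of positive definite matrices decreases under the partial trace. -/
theorem relativeEntropy_partialTrace_le {ι κ ι' κ' : Type*} [Fintype ι] [DecidableEq ι]
    [Fintype κ] [DecidableEq κ] [Fintype ι'] [DecidableEq ι'] [Fintype κ'] [DecidableEq κ']
    {ρ σ : Matrix (α × β) (α × β) ℂ}
    {U : Matrix (α × β) ι ℂ} {r : ι → ℝ} {V : Matrix (α × β) κ ℂ} {s : κ → ℝ}
    {U' : Matrix α ι' ℂ} {r' : ι' → ℝ} {V' : Matrix α κ' ℂ} {s' : κ' → ℝ}
    (hρ : IsDiagonalization ρ U r) (hσ : IsDiagonalization σ V s)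
    (hρ' : IsDiagonalization (partialTrace ρ) U' r')
    (hσ' : IsDiagonalization (partialTrace σ) V' s')
    (hr : ∀ i, 0 < r i) (hs : ∀ i, 0 < s i) (hr' : ∀ i, 0 < r' i) (hs' : ∀ i, 0 < s' i) :
    (trace (ρ * (V * diagonal (fun j => (Real.log (s j) : ℂ)) * Vᴴ))).re
        - ∑ i, r i * Real.log (r i) ≤
      (trace (partialTrace ρ * (V' * diagonal (fun j => (Real.log (s' j) : ℂ)) * V'ᴴ))).re
        - ∑ i, r' i * Real.log (r' i) := by
  -- Both sides become means of log(s_j / r_i) with weights r_i |⟨u_i, v_j⟩|².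
  rw [← sum_weights_mul hρ, ← sum_weights_mul hρ', ← sum_weights_mul_left hρ hσ,
    ← sum_weights_mul_left hρ' hσ']
  simp only [← Finset.sum_sub_distrib, ← mul_sub, ← Real.log_div (hs _).ne' (hr _).ne',
    ← Real.log_div (hs' _).ne' (hr' _).ne', ← Fintype.sum_prod_type']
  refine sum_mul_log_le_of_resolvent_le (fun p => div_pos (hs _) (hr _))
    (fun p => div_pos (hs' _) (hr' _)) ?_ fun t ht => ?_
  -- Both masses equal the trace of ρ, which the partial trace preserves.
  · have h1 := sum_weights_mul_left hρ hσ (fun _ => 1)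
    have h2 := sum_weights_mul_left hρ' hσ' (fun _ => 1)
    have h3 := hρ.trace_mul_conj 1
    have h4 := hρ'.trace_mul_conj 1
    have h5 := trace_mul_kronecker_one ρ 1
    rw [Matrix.mul_one, hρ.mul_conjTranspose] at h3
    rw [Matrix.mul_one, hρ'.mul_conjTranspose] at h4
    rw [one_kronecker_one, h3, h4] at h5
    simp only [mul_one, one_apply_eq] at h1 h2 h5
    rw [Fintype.sum_prod_type, Fintype.sum_prod_type, h1, h2]
    exact_mod_cast h5
  · have aux : ∀ r s m : ℝ, 0 < r → 0 < s → r * m / (s / r + t) = r ^ 2 * m / (s + t * r) := by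
      intro r s m hr hs
      field_simp
    simp only [aux _ _ _ (hr _) (hs _), aux _ _ _ (hr' _) (hs' _), Fintype.sum_prod_type]
    -- The optimal `Y` for the marginals, tensored with 1, competes in the full problem.
    obtain ⟨Y, hY⟩ := exists_resolventForm_eq hρ' hσ' hr' hs' ht
    rw [← hY, ← resolventForm_kronecker_one]
    exact resolventForm_le hρ hσ hr hs ht _

end PartialTrace

open scoped ComplexOrder

/-! ### Spectral form of entropy and of A ⊗ 1 -/

section Diagonalization

variable {n ι : Type*} [Fintype n] [DecidableEq n] [Fintype ι] [DecidableEq ι]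

theorem _root_.Matrix.IsHermitian.isDiagonalization {A : Matrix n n ℂ} (hA : A.IsHermitian) :
    IsDiagonalization A (hA.eigenvectorUnitary : Matrix n n ℂ) hA.eigenvalues where
  mul_conjTranspose := Unitary.coe_mul_star_self hA.eigenvectorUnitary
  conjTranspose_mul := Unitary.coe_star_mul_self hA.eigenvectorUnitary
  eq := by
    conv_lhs => rw [hA.spectral_theorem, Unitary.conjStarAlgAut_apply]
    rfl

theorem entropy_eq_sum_eigenvalues {A : Matrix n n ℂ} (hA : A.IsHermitian) :
    entropy A = ∑ i, Real.negMulLog (hA.eigenvalues i) := by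
  have h : A * cfc Real.log A = A * ((hA.eigenvectorUnitary : Matrix n n ℂ) *
      diagonal (fun i => ((Real.log (hA.eigenvalues i) : ℝ) : ℂ)) *
        (hA.eigenvectorUnitary : Matrix n n ℂ)ᴴ) := by
    rw [hA.cfc_eq, Matrix.IsHermitian.cfc, Unitary.conjStarAlgAut_apply]
    rfl
  rw [entropy, h, hA.isDiagonalization.trace_mul_conj, Complex.re_sum, ← Finset.sum_neg_distrib]
  refine Finset.sum_congr rfl fun i _ => ?_
  rw [diagonal_apply_eq, ← Complex.ofReal_mul, Complex.ofReal_re, Real.negMulLog, neg_mul]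

theorem IsDiagonalization.add_smul_one {ρ : Matrix n n ℂ} {U : Matrix n ι ℂ} {r : ι → ℝ}
    (h : IsDiagonalization ρ U r) (c : ℝ) :
    IsDiagonalization (ρ + (c : ℂ) • (1 : Matrix n n ℂ)) U (fun i => r i + c) where
  mul_conjTranspose := h.mul_conjTranspose
  conjTranspose_mul := h.conjTranspose_mul
  eq := by
    have : diagonal (fun i => ((r i + c : ℝ) : ℂ)) =
        diagonal (fun i => (r i : ℂ)) + (c : ℂ) • (1 : Matrix ι ι ℂ) := by
      rw [smul_one_eq_diagonal, diagonal_add]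
      simp
    rw [this, Matrix.mul_add, Matrix.add_mul, ← h.eq, Matrix.mul_smul, Matrix.mul_one,
      Matrix.smul_mul, h.mul_conjTranspose]

theorem diagonal_comp_fst {ι α : Type*} [DecidableEq ι] [DecidableEq α] (g : ι → ℂ) :
    diagonal (fun p : ι × α => g p.1) = diagonal g ⊗ₖ (1 : Matrix α α ℂ) := by
  rw [← diagonal_one, diagonal_kronecker_diagonal]
  simp

theorem IsDiagonalization.kronecker_one {m α : Type*} [Fintype m] [DecidableEq m]
    [Fintype α] [DecidableEq α] {A : Matrix n n ℂ} {W : Matrix n ι ℂ} {s : ι → ℝ}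
    (h : IsDiagonalization A W s) (e : m ≃ n × α) :
    IsDiagonalization ((A ⊗ₖ (1 : Matrix α α ℂ)).submatrix e e)
      ((W ⊗ₖ (1 : Matrix α α ℂ)).submatrix e id) (fun p => s p.1) where
  mul_conjTranspose := by
    rw [conjTranspose_submatrix, ← submatrix_mul _ _ _ _ _ Function.bijective_id, conjTranspose_kronecker,
      ← mul_kronecker_mul, h.mul_conjTranspose, conjTranspose_one, Matrix.one_mul,
      one_kronecker_one, submatrix_one_equiv]
  conjTranspose_mul := by
    rw [conjTranspose_submatrix, submatrix_mul_equiv, conjTranspose_kronecker,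
      ← mul_kronecker_mul, h.conjTranspose_mul, conjTranspose_one, Matrix.one_mul,
      one_kronecker_one, submatrix_id_id]
  eq := by
    rw [diagonal_comp_fst (fun i => (s i : ℂ)), ← submatrix_id_id (diagonal _ ⊗ₖ _), conjTranspose_submatrix,
      ← submatrix_mul _ _ _ _ _ Function.bijective_id,
      ← submatrix_mul _ _ _ _ _ Function.bijective_id,
      conjTranspose_kronecker, ← mul_kronecker_mul, ← mul_kronecker_mul, ← h.eq,
      conjTranspose_one, Matrix.one_mul, Matrix.one_mul]

/-- If `e` splits off a factor `α`, then averaging the function `g(A) ⊗ 1` of the reduced matrix `A`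
against `ρ` gives the trace of `A * g(A)`. -/
theorem IsDiagonalization.trace_mul_kronecker_one {m α : Type*} [Fintype m] [DecidableEq m]
    [Fintype α] [DecidableEq α] {ρ : Matrix m m ℂ} {e : m ≃ n × α} {W : Matrix n ι ℂ} {s : ι → ℝ}
    (h : IsDiagonalization (partialTrace (ρ.submatrix e.symm e.symm)) W s) (g : ι → ℝ) :
    (trace (ρ * ((W ⊗ₖ (1 : Matrix α α ℂ)).submatrix e id *
      diagonal (fun p : ι × α => (g p.1 : ℂ)) *
        ((W ⊗ₖ (1 : Matrix α α ℂ)).submatrix e id)ᴴ))).re = ∑ i, s i * g i := by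
  have h1 : (W ⊗ₖ (1 : Matrix α α ℂ)).submatrix e id *
      diagonal (fun p : ι × α => (g p.1 : ℂ)) * ((W ⊗ₖ (1 : Matrix α α ℂ)).submatrix e id)ᴴ =
      ((W * diagonal (fun i => (g i : ℂ)) * Wᴴ) ⊗ₖ (1 : Matrix α α ℂ)).submatrix e e := by
    rw [diagonal_comp_fst (fun i => (g i : ℂ)), ← submatrix_id_id (diagonal _ ⊗ₖ _),
      conjTranspose_submatrix, ← submatrix_mul _ _ _ _ _ Function.bijective_id,
      ← submatrix_mul _ _ _ _ _ Function.bijective_id,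
      conjTranspose_kronecker, ← mul_kronecker_mul, ← mul_kronecker_mul,
      conjTranspose_one, Matrix.one_mul, Matrix.one_mul]
  have h2 : ρ = (ρ.submatrix e.symm e.symm).submatrix e e := by simp
  rw [h1]
  conv_lhs => rw [h2]
  have h3 : ∀ M : Matrix (n × α) (n × α) ℂ, trace (M.submatrix e e) = trace M :=
    fun M => e.sum_comp fun i => M i i
  rw [submatrix_mul_equiv, h3, FermionEntropy.trace_mul_kronecker_one,
    h.trace_mul_conj, Complex.re_sum]
  refine Finset.sum_congr rfl fun i _ => ?_
  rw [diagonal_apply_eq, ← Complex.ofReal_mul, Complex.ofReal_re]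

end Diagonalization

/-! ### Strong subadditivity -/

section StrongSubadditivity

/-- Exchange of the last two factors of a threefold product. -/
def swapLast (β α γ : Type*) : (β × α) × γ ≃ (β × γ) × α where
  toFun p := ((p.1.1, p.2), p.1.2)
  invFun p := ((p.1.1, p.2), p.1.2)

/-- The partial trace over the middle factor. -/
def partialTraceMid {α β γ : Type*} [Fintype α] (ρ : Matrix ((β × α) × γ) ((β × α) × γ) ℂ) :
    Matrix (β × γ) (β × γ) ℂ :=
  partialTrace (ρ.submatrix (swapLast β α γ).symm (swapLast β α γ).symm)

theorem partialTrace_partialTraceMid {α β γ : Type*} [Fintype α] [Fintype γ]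
    (ρ : Matrix ((β × α) × γ) ((β × α) × γ) ℂ) :
    partialTrace (partialTraceMid ρ) = partialTrace (partialTrace ρ) := by
  ext x y
  exact Finset.sum_comm

theorem partialTrace_add_smul_one {α β : Type*} [DecidableEq α] [Fintype β] [DecidableEq β]
    (A : Matrix (α × β) (α × β) ℂ) (c : ℝ) :
    partialTrace (A + (c : ℂ) • (1 : Matrix (α × β) (α × β) ℂ)) =
      partialTrace A + ((Fintype.card β * c : ℝ) : ℂ) • (1 : Matrix α α ℂ) := by
  ext x y
  simp [partialTrace, one_apply, Finset.sum_add_distrib]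

theorem partialTraceMid_add_smul_one {α β γ : Type*} [Fintype α] [DecidableEq α]
    [DecidableEq β] [DecidableEq γ] (ρ : Matrix ((β × α) × γ) ((β × α) × γ) ℂ) (c : ℝ) :
    partialTraceMid (ρ + (c : ℂ) • (1 : Matrix ((β × α) × γ) ((β × α) × γ) ℂ)) =
      partialTraceMid ρ + ((Fintype.card α * c : ℝ) : ℂ) • (1 : Matrix (β × γ) (β × γ) ℂ) := by
  rw [partialTraceMid, partialTraceMid, ← partialTrace_add_smul_one, submatrix_add, Pi.add_apply,
    Pi.add_apply, submatrix_smul, Pi.smul_apply, Pi.smul_apply, submatrix_one_equiv]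

theorem _root_.Matrix.PosSemidef.partialTrace {α β : Type*} [Fintype α] [Fintype β]
    {ρ : Matrix (α × β) (α × β) ℂ} (hρ : ρ.PosSemidef) :
    (FermionEntropy.partialTrace ρ).PosSemidef := by
  have : FermionEntropy.partialTrace ρ = ∑ b, ρ.submatrix (fun a => (a, b)) (fun a => (a, b)) := by
    ext x y
    simp [FermionEntropy.partialTrace, Matrix.sum_apply]
  rw [this]
  exact posSemidef_sum _ fun b _ => hρ.submatrix _

theorem _root_.Matrix.PosSemidef.partialTraceMid {α β γ : Type*} [Fintype α] [Fintype β]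
    [Fintype γ] {ρ : Matrix ((β × α) × γ) ((β × α) × γ) ℂ} (hρ : ρ.PosSemidef) :
    (FermionEntropy.partialTraceMid ρ).PosSemidef :=
  (hρ.submatrix _).partialTrace

variable {α β γ : Type*} [Fintype α] [DecidableEq α] [Fintype β] [DecidableEq β]
  [Fintype γ] [DecidableEq γ]

theorem strongSubadditivity_of_diagonalization {ι κ ι' κ' : Type*} [Fintype ι] [DecidableEq ι]
    [Fintype κ] [DecidableEq κ] [Fintype ι'] [DecidableEq ι'] [Fintype κ'] [DecidableEq κ']
    {ρ : Matrix ((β × α) × γ) ((β × α) × γ) ℂ}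
    {U : Matrix ((β × α) × γ) ι ℂ} {r : ι → ℝ} {W : Matrix (β × γ) κ ℂ} {s : κ → ℝ}
    {U' : Matrix (β × α) ι' ℂ} {r' : ι' → ℝ} {W' : Matrix β κ' ℂ} {s' : κ' → ℝ}
    (hρ : IsDiagonalization ρ U r) (hσ : IsDiagonalization (partialTraceMid ρ) W s)
    (hρ' : IsDiagonalization (partialTrace ρ) U' r')
    (hσ' : IsDiagonalization (partialTrace (partialTrace ρ)) W' s')
    (hr : ∀ i, 0 < r i) (hs : ∀ i, 0 < s i) (hr' : ∀ i, 0 < r' i) (hs' : ∀ i, 0 < s' i) :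
    ∑ i, Real.negMulLog (r i) + ∑ i, Real.negMulLog (s' i) ≤
      ∑ i, Real.negMulLog (r' i) + ∑ i, Real.negMulLog (s i) := by
  have hτ := hσ.kronecker_one (α := α) (swapLast β α γ)
  have hτ' := hσ'.kronecker_one (α := α) (Equiv.refl (β × α))
  -- Tracing C out of ρ_BC ⊗ 1_A leaves ρ_B ⊗ 1_A.
  have hptr : partialTrace ((partialTraceMid ρ ⊗ₖ (1 : Matrix α α ℂ)).submatrix
      (swapLast β α γ) (swapLast β α γ)) =
      (partialTrace (partialTrace ρ) ⊗ₖ (1 : Matrix α α ℂ)).submatrix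
        (Equiv.refl (β × α)) (Equiv.refl (β × α)) := by
    rw [← partialTrace_partialTraceMid]
    ext x y
    simp [partialTrace, swapLast, Finset.sum_mul]
  rw [← hptr] at hτ'
  have key := relativeEntropy_partialTrace_le hρ hτ hρ' hτ' hr (fun p => hs p.1) hr'
    (fun p => hs' p.1)
  rw [IsDiagonalization.trace_mul_kronecker_one hσ (fun i => Real.log (s i)),
    IsDiagonalization.trace_mul_kronecker_one (ρ := partialTrace ρ) (e := Equiv.refl (β × α)) hσ'
      (fun i => Real.log (s' i))] at key
  simp only [Real.negMulLog, neg_mul, Finset.sum_neg_distrib]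
  linarith

theorem tendsto_sum_negMulLog_add {ν : Type*} [Fintype ν] (r : ν → ℝ) (c : ℝ) :
    Tendsto (fun ε => ∑ i, Real.negMulLog (r i + c * ε)) (𝓝[>] 0)
      (𝓝 (∑ i, Real.negMulLog (r i))) := by
  have h : Continuous fun ε => ∑ i, Real.negMulLog (r i + c * ε) := by fun_prop
  simpa using h.continuousWithinAt.tendsto (x := 0) (s := Set.Ioi 0)

/-- **Strong subadditivity** of the von Neumann entropy. -/
theorem strongSubadditivity [Nonempty α] [Nonempty γ]
    {ρ : Matrix ((β × α) × γ) ((β × α) × γ) ℂ} (hρ : ρ.PosSemidef) :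
    entropy ρ + entropy (partialTrace (partialTrace ρ)) ≤
      entropy (partialTrace ρ) + entropy (partialTraceMid ρ) := by
  have hσ := hρ.partialTraceMid
  have hρ' := hρ.partialTrace
  have hσ' := hρ'.partialTrace
  rw [entropy_eq_sum_eigenvalues hρ.isHermitian, entropy_eq_sum_eigenvalues hσ.isHermitian,
    entropy_eq_sum_eigenvalues hρ'.isHermitian, entropy_eq_sum_eigenvalues hσ'.isHermitian]
  -- Replace ρ by ρ + ε 1 to make all spectra positive; each marginal shifts by ε times the
  -- dimension traced out. Continuity of `negMulLog` then allows ε → 0.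
  have hcont : ∀ ε : ℝ, 0 < ε →
      ∑ i, Real.negMulLog (hρ.isHermitian.eigenvalues i + 1 * ε) +
        ∑ i, Real.negMulLog (hσ'.isHermitian.eigenvalues i +
          Fintype.card α * Fintype.card γ * ε) ≤
      ∑ i, Real.negMulLog (hρ'.isHermitian.eigenvalues i + Fintype.card γ * ε) +
        ∑ i, Real.negMulLog (hσ.isHermitian.eigenvalues i + Fintype.card α * ε) := by
    intro ε hε
    have hα : 0 < (Fintype.card α : ℝ) := by exact_mod_cast Fintype.card_pos
    have hγ : 0 < (Fintype.card γ : ℝ) := by exact_mod_cast Fintype.card_pos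
    have d := hρ.isHermitian.isDiagonalization.add_smul_one (1 * ε)
    have dσ := hσ.isHermitian.isDiagonalization.add_smul_one (Fintype.card α * ε)
    have dρ' := hρ'.isHermitian.isDiagonalization.add_smul_one (Fintype.card γ * ε)
    have dσ' := hσ'.isHermitian.isDiagonalization.add_smul_one
      (Fintype.card α * Fintype.card γ * ε)
    rw [one_mul] at d ⊢
    rw [← partialTraceMid_add_smul_one] at dσ
    rw [← partialTrace_add_smul_one] at dρ'
    rw [mul_assoc, ← partialTrace_add_smul_one, ← partialTrace_add_smul_one] at dσ'
    simp only [mul_assoc]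
    exact strongSubadditivity_of_diagonalization d dσ dρ' dσ'
      (fun i => add_pos_of_nonneg_of_pos (hρ.eigenvalues_nonneg i) hε)
      (fun i => add_pos_of_nonneg_of_pos (hσ.eigenvalues_nonneg i) (by positivity))
      (fun i => add_pos_of_nonneg_of_pos (hρ'.eigenvalues_nonneg i) (by positivity))
      (fun i => add_pos_of_nonneg_of_pos (hσ'.eigenvalues_nonneg i) (by positivity))
  exact le_of_tendsto_of_tendsto
    ((tendsto_sum_negMulLog_add _ _).add (tendsto_sum_negMulLog_add _ _))
    ((tendsto_sum_negMulLog_add _ _).add (tendsto_sum_negMulLog_add _ _))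
    (eventually_nhdsWithin_of_forall hcont)

end StrongSubadditivity

/-! ### Entropy as a function of the characteristic polynomial -/

section Spectral

variable {m n : Type*} [Fintype m] [DecidableEq m] [Fintype n] [DecidableEq n]

theorem entropy_eq_sum_roots {A : Matrix n n ℂ} (hA : A.IsHermitian) :
    entropy A = (A.charpoly.roots.map fun z => Real.negMulLog z.re).sum := by
  rw [entropy_eq_sum_eigenvalues hA, hA.roots_charpoly_eq_eigenvalues, Multiset.map_map]
  rfl

theorem entropy_submatrix_equiv {A : Matrix n n ℂ} (hA : A.IsHermitian) (e : m ≃ n) :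
    entropy (A.submatrix e e) = entropy A := by
  rw [entropy_eq_sum_roots hA, entropy_eq_sum_roots (hA.submatrix e)]
  have := charpoly_reindex e.symm A
  rw [reindex_apply, Equiv.symm_symm] at this
  rw [this]

theorem entropy_transpose {A : Matrix n n ℂ} (hA : A.IsHermitian) :
    entropy Aᵀ = entropy A := by
  rw [entropy_eq_sum_roots hA, entropy_eq_sum_roots hA.transpose, charpoly_transpose]

/-- The two marginals of a pure state have the same entropy. -/
theorem entropy_mul_conjTranspose (A : Matrix m n ℂ) : entropy (A * Aᴴ) = entropy (Aᴴ * A) := by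
  rw [entropy_eq_sum_roots (isHermitian_mul_conjTranspose_self A),
    entropy_eq_sum_roots (isHermitian_conjTranspose_mul_self A)]
  have h := congrArg (fun p => (p.roots.map fun z : ℂ => Real.negMulLog z.re).sum)
    (charpoly_mul_comm' A Aᴴ)
  -- The surplus roots are zero and contribute 0 log 0 = 0.
  have hX : ∀ (p : Polynomial ℂ) (k : ℕ), p.Monic →
      (((Polynomial.X ^ k * p).roots.map fun z : ℂ => Real.negMulLog z.re).sum) =
        (p.roots.map fun z : ℂ => Real.negMulLog z.re).sum := by
    intro p k hp
    rw [Polynomial.roots_mul ((Polynomial.monic_X_pow k).mul hp).ne_zero, Polynomial.roots_X_pow]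
    simp [Multiset.map_nsmul, Multiset.sum_nsmul]
  simpa only [hX _ _ (charpoly_monic _)] using h

end Spectral

/-! ### Reduced density matrices of a permutation-invariant state -/

section ReducedDensity

variable {d N : ℕ}

theorem isPermutationInvariant_of_mem_antisymmetricSubspace {Ψ : TensorPower d N}
    (hΨ : Ψ ∈ antisymmetricSubspace d N) : IsPermutationInvariant (pureState Ψ) := by
  intro σ x y
  simp only [pureState, of_apply]
  rw [hΨ σ x, hΨ σ y]
  rcases Int.units_eq_one_or (Equiv.Perm.sign σ) with h | h <;> simp [h]

theorem isPermutationInvariant_of_mem_symmetricSubspace {Ψ : TensorPower d N}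
    (hΨ : Ψ ∈ symmetricSubspace d N) : IsPermutationInvariant (pureState Ψ) := by
  intro σ x y
  simp only [pureState, of_apply]
  rw [hΨ σ x, hΨ σ y]

/-- The coefficients of `Ψ` as a matrix between the first `k` and the last `N - k` factors. -/
def coefficientMatrix (Ψ : TensorPower d N) (k : ℕ) :
    Matrix (Fin k → Fin d) (Fin (N - k) → Fin d) ℂ :=
  Matrix.of fun x z => Ψ (concat x z)

theorem reducedDensity_pureState (Ψ : TensorPower d N) (k : ℕ) :
    reducedDensity (pureState Ψ) k = coefficientMatrix Ψ k * (coefficientMatrix Ψ k)ᴴ :=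
  rfl

theorem posSemidef_reducedDensity_pureState (Ψ : TensorPower d N) (k : ℕ) :
    (reducedDensity (pureState Ψ) k).PosSemidef := by
  rw [reducedDensity_pureState]
  exact posSemidef_self_mul_conjTranspose _

theorem IsPermutationInvariant.reducedDensity {ρ : Op d N} (hρ : IsPermutationInvariant ρ)
    {k : ℕ} (hk : k ≤ N) : IsPermutationInvariant (reducedDensity ρ k) := by
  intro σ x y
  let f : Fin k ≃ {i : Fin N // (i : ℕ) < k} :=
    { toFun := fun i => ⟨⟨i, by omega⟩, i.2⟩
      invFun := fun i => ⟨i.1, i.2⟩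
      left_inv := fun i => rfl
      right_inv := fun i => rfl }
  have h : ∀ (x : Fin k → Fin d) (z : Fin (N - k) → Fin d),
      concat (x ∘ σ) z = concat x z ∘ σ.extendDomain f := by
    intro x z
    ext1 i
    by_cases hi : (i : ℕ) < k
    · have := (f (σ (f.symm ⟨i, hi⟩))).2
      rw [Function.comp_apply, Equiv.Perm.extendDomain_apply_subtype σ f hi]
      rw [concat, concat, dif_pos hi, dif_pos this]
      rfl
    · rw [Function.comp_apply, Equiv.Perm.extendDomain_apply_not_subtype σ f hi]
      rw [concat, concat, dif_neg hi, dif_neg hi]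
  simp only [FermionEntropy.reducedDensity, of_apply, h]
  exact Finset.sum_congr rfl fun z _ => hρ _ _ _

/-- Splitting off the last tensor factor on basis indices. -/
def snocEquiv (d n : ℕ) : (Fin n → Fin d) × Fin d ≃ (Fin (n + 1) → Fin d) :=
  (Equiv.prodComm _ _).trans (Fin.snocEquiv fun _ => Fin d)

theorem snocEquiv_apply {n : ℕ} (p : (Fin n → Fin d) × Fin d) :
    snocEquiv d n p = Fin.snoc (α := fun _ => Fin d) p.1 p.2 := rfl

theorem partialTrace_reducedDensity (ρ : Op d N) {k : ℕ} (hk : k + 1 ≤ N) :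
    partialTrace ((reducedDensity ρ (k + 1)).submatrix (snocEquiv d k) (snocEquiv d k)) =
      reducedDensity ρ k := by
  have hN : N - k = N - (k + 1) + 1 := by omega
  -- The first traced-out factor is split off; it becomes the last factor of the (k + 1)-body
  -- matrix.
  let e : Fin d × (Fin (N - (k + 1)) → Fin d) ≃ (Fin (N - k) → Fin d) :=
    (Fin.consEquiv fun _ => Fin d).trans (Equiv.arrowCongr (finCongr hN.symm) (Equiv.refl _))
  have he : ∀ (x : Fin k → Fin d) (p : Fin d × (Fin (N - (k + 1)) → Fin d)),
      concat x (e p) = concat (N := N) (snocEquiv d k (x, p.1)) p.2 := by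
    rintro x ⟨a, z⟩
    ext1 i
    rw [snocEquiv_apply]
    rcases lt_trichotomy (i : ℕ) k with hi | hi | hi
    · simp [concat, hi, Nat.lt_succ_of_lt hi, Fin.snoc]
    · simp [concat, hi, Fin.snoc, e, Fin.consEquiv]
    · have h1 : ¬ (i : ℕ) < k := by omega
      have h2 : ¬ (i : ℕ) < k + 1 := by omega
      simp only [concat, h1, h2, dif_neg, not_false_eq_true]
      have h3 : (finCongr hN) ⟨(i : ℕ) - k, by omega⟩ = Fin.succ ⟨(i : ℕ) - (k + 1), by omega⟩ := by
        ext
        simp only [finCongr_apply, Fin.val_cast, Fin.val_succ]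
        omega
      change Fin.cons (α := fun _ => Fin d) a z ((finCongr hN) ⟨(i : ℕ) - k, by omega⟩) = _
      rw [h3, Fin.cons_succ]
  ext x y
  simp only [partialTrace, reducedDensity, of_apply, submatrix_apply, ← e.sum_comp, he,
    Fintype.sum_prod_type]

/-- Swapping the last two factors turns the trace over the middle one into the trace over the last.
-/
theorem partialTraceMid_reducedDensity {ρ : Op d N} (hρ : IsPermutationInvariant ρ) {b : ℕ}
    (hb : b + 2 ≤ N) :
    partialTraceMid ((reducedDensity ρ (b + 2)).submatrix
      (((snocEquiv d b).prodCongr (Equiv.refl (Fin d))).trans (snocEquiv d (b + 1)))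
      (((snocEquiv d b).prodCongr (Equiv.refl (Fin d))).trans (snocEquiv d (b + 1)))) =
      (reducedDensity ρ (b + 1)).submatrix (snocEquiv d b) (snocEquiv d b) := by
  have hswap : ∀ (x : Fin b → Fin d) (a c : Fin d),
      snocEquiv d (b + 1) (snocEquiv d b (x, a), c) =
        snocEquiv d (b + 1) (snocEquiv d b (x, c), a) ∘
          Equiv.swap (Fin.last (b + 1)) (Fin.last b).castSucc := by
    intro x a c
    ext1 i
    simp only [snocEquiv_apply, Function.comp_apply]
    refine Fin.lastCases ?_ (fun i => ?_) i
    · simp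
    · refine Fin.lastCases ?_ (fun i => ?_) i
      · simp
      · rw [Equiv.swap_apply_of_ne_of_ne (Fin.castSucc_lt_last _).ne
          (by simp)]
        simp
  rw [← partialTrace_reducedDensity ρ hb]
  ext ⟨x, c⟩ ⟨y, c'⟩
  simp only [partialTraceMid, partialTrace, of_apply, submatrix_apply]
  refine Finset.sum_congr rfl fun a _ => ?_
  change reducedDensity ρ (b + 2) (snocEquiv d (b + 1) (snocEquiv d b (x, a), c))
    (snocEquiv d (b + 1) (snocEquiv d b (y, a), c')) = _
  rw [hswap x, hswap y, hρ.reducedDensity hb]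

theorem entropy_concave {Ψ : TensorPower d N} (hΨ : IsPermutationInvariant (pureState Ψ))
    (hd : 0 < d) {b : ℕ} (hb : b + 2 ≤ N) :
    entropy (reducedDensity (pureState Ψ) (b + 2)) + entropy (reducedDensity (pureState Ψ) b) ≤
      2 * entropy (reducedDensity (pureState Ψ) (b + 1)) := by
  have : Nonempty (Fin d) := ⟨⟨0, hd⟩⟩
  have hpos := posSemidef_reducedDensity_pureState Ψ
  have key := strongSubadditivity ((hpos (b + 2)).submatrix
    (((snocEquiv d b).prodCongr (Equiv.refl (Fin d))).trans (snocEquiv d (b + 1))))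
  have h1 : partialTrace ((reducedDensity (pureState Ψ) (b + 2)).submatrix
      (((snocEquiv d b).prodCongr (Equiv.refl (Fin d))).trans (snocEquiv d (b + 1)))
      (((snocEquiv d b).prodCongr (Equiv.refl (Fin d))).trans (snocEquiv d (b + 1)))) =
      (reducedDensity (pureState Ψ) (b + 1)).submatrix (snocEquiv d b) (snocEquiv d b) := by
    rw [← partialTrace_reducedDensity _ hb]
    rfl
  rw [partialTraceMid_reducedDensity hΨ hb, h1, partialTrace_reducedDensity _ (by omega),
    entropy_submatrix_equiv (hpos _).isHermitian, entropy_submatrix_equiv (hpos _).isHermitian]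
    at key
  linarith

theorem entropy_reducedDensity_compl {Ψ : TensorPower d N}
    (hΨ : IsPermutationInvariant (pureState Ψ)) {k : ℕ} (hk : k ≤ N) :
    entropy (reducedDensity (pureState Ψ) (N - k)) = entropy (reducedDensity (pureState Ψ) k) := by
  -- With A the coefficient matrix, AᴴA is the transpose of the density matrix of the last N - k
  -- factors.
  rw [reducedDensity_pureState Ψ k, entropy_mul_conjTranspose,
    ← entropy_transpose (isHermitian_conjTranspose_mul_self _)]
  congr 1
  -- The rotation carrying the first k positions past the other N - k.
  let σ : Equiv.Perm (Fin N) :=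
    { toFun := fun i => if h : (i : ℕ) < k then ⟨i + (N - k), by omega⟩ else ⟨i - k, by omega⟩
      invFun := fun i => if h : (i : ℕ) < N - k then ⟨i + k, by omega⟩ else
        ⟨i - (N - k), by omega⟩
      left_inv := fun i => by
        by_cases h : (i : ℕ) < k
        · simp [h]
        · have : (i : ℕ) - k < N - k := by omega
          simp only [h, dif_neg, not_false_eq_true, this, dif_pos]
          ext
          simp only
          omega
      right_inv := fun i => by
        by_cases h : (i : ℕ) < N - k
        · simp [h]
        · have : (i : ℕ) - (N - k) < k := by omega
          simp only [h, dif_neg, not_false_eq_true, this, dif_pos]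
          ext
          simp only
          omega }
  have hN : N - (N - k) = k := by omega
  have h : ∀ (z : Fin (N - k) → Fin d) (x : Fin (N - (N - k)) → Fin d),
      concat (N := N) (x ∘ Fin.cast hN.symm) z = concat z x ∘ σ := by
    intro z x
    ext1 i
    rw [Function.comp_apply]
    by_cases hi : (i : ℕ) < k
    · have hσ : σ i = ⟨i + (N - k), by omega⟩ := dif_pos hi
      rw [hσ, concat, concat, dif_pos hi, dif_neg (by simp)]
      simp only [Function.comp_apply, Nat.add_sub_cancel]
      rfl
    · have hσ : σ i = ⟨i - k, by omega⟩ := dif_neg hi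
      rw [hσ, concat, concat, dif_neg hi, dif_pos (by simp only; omega)]
  ext z w
  simp only [reducedDensity, of_apply, transpose_apply, Matrix.mul_apply, conjTranspose_apply,
    coefficientMatrix]
  rw [← (Equiv.arrowCongr (finCongr hN) (Equiv.refl (Fin d))).sum_comp]
  refine Finset.sum_congr rfl fun x _ => ?_
  rw [← hΨ σ]
  change _ = star (Ψ (concat (x ∘ Fin.cast hN.symm) w)) * Ψ (concat (x ∘ Fin.cast hN.symm) z)
  rw [h, h, mul_comm]
  rfl

end ReducedDensity

end FermionEntropy

open FermionEntropy in
theorem theorem1 (d N : ℕ) (Ψ : TensorPower d N) (hnorm : ‖Ψ‖ = 1)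
    (hΨ : Ψ ∈ antisymmetricSubspace d N ∨ Ψ ∈ symmetricSubspace d N ∨
      IsPermutationInvariant (pureState Ψ)) :
    (∀ k : ℕ, 1 ≤ k → (k : ℝ) ≤ (N : ℝ) / 2 - 1 →
      entropy (reducedDensity (pureState Ψ) k) ≤
        entropy (reducedDensity (pureState Ψ) (k + 1))) ∧
    (∀ k : ℕ, 2 ≤ k → k ≤ N - 1 →
      entropy (reducedDensity (pureState Ψ) k) ≥
        (entropy (reducedDensity (pureState Ψ) (k + 1)) +
          entropy (reducedDensity (pureState Ψ) (k - 1))) / 2) := by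
  have hinv : IsPermutationInvariant (pureState Ψ) := by
    rcases hΨ with h | h | h
    · exact isPermutationInvariant_of_mem_antisymmetricSubspace h
    · exact isPermutationInvariant_of_mem_symmetricSubspace h
    · exact h
  -- For d = 0 and N ≥ 1 the space is zero and has no unit vector.
  have hd : 1 ≤ N → 0 < d := by
    intro hN
    by_contra hd
    obtain rfl : d = 0 := by omega
    have : IsEmpty (Fin N → Fin 0) := ⟨fun x => (x ⟨0, hN⟩).elim0⟩
    have : Ψ = 0 := Subsingleton.elim _ _
    simp [this] at hnorm
  have hconc : ∀ b, b + 2 ≤ N →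
      entropy (reducedDensity (pureState Ψ) (b + 2)) + entropy (reducedDensity (pureState Ψ) b) ≤
        2 * entropy (reducedDensity (pureState Ψ) (b + 1)) :=
    fun b hb => entropy_concave hinv (hd (by omega)) hb
  refine ⟨fun k hk hkN => ?_, fun k hk hkN => ?_⟩
  · have hkN' : 2 * k + 2 ≤ N := by
      have : (2 * k + 2 : ℝ) ≤ N := by linarith
      exact_mod_cast this
    have hdiff : ∀ j, k + j + 1 ≤ N →
        entropy (reducedDensity (pureState Ψ) (k + j + 1)) -
            entropy (reducedDensity (pureState Ψ) (k + j)) ≤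
          entropy (reducedDensity (pureState Ψ) (k + 1)) -
            entropy (reducedDensity (pureState Ψ) k) := by
      intro j
      induction j with
      | zero => exact fun _ => le_rfl
      | succ j ih =>
        intro hj
        have h1 := ih (by omega)
        have h2 := hconc (k + j) (by omega)
        rw [← add_assoc k j 1]
        rw [show k + j + 2 = k + j + 1 + 1 from rfl] at h2
        linarith
    -- This j selects the increment from N - k - 1 to N - k, the reflection of the one from k to k +
    -- 1 with opposite sign.
    have h1 := hdiff (N - (2 * k + 1)) (by omega)
    rw [show k + (N - (2 * k + 1)) + 1 = N - k by omega,
      show k + (N - (2 * k + 1)) = N - (k + 1) by omega,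
      entropy_reducedDensity_compl hinv (by omega),
      entropy_reducedDensity_compl hinv (by omega)] at h1
    linarith
  · obtain ⟨b, rfl⟩ : ∃ b, k = b + 1 := ⟨k - 1, by omega⟩
    have h := hconc b (by omega)
    rw [Nat.add_sub_cancel]
    rw [show b + 2 = b + 1 + 1 from rfl] at h
    linarith
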